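/- **Deque sorting.** Let $\pi$ be a permutation of $\{1,\dots,n\}$. A state of a deque switchyard consists of three lists: output, deque, input. The four operations are: $a$ (resp. $b$), remove the first element of a nonempty input and add it to the left (resp. right) end of the deque; $y$ (resp. $z$), remove the left (resp. right) end element of a nonempty deque and append it to the end of the output. A run of $\pi$ is a sequence of states, each obtained from the previous one by one of these operations, that starts with empty output, empty deque and input $\pi(1),\dots,\pi(n)$. It is successful if it takes $2n$ steps and ends with output $1,2,\dots,n$ and with deque and input empty. The permutation $\pi$ is sortable on a deque if it has a successful run. **The algorithm.** A twinstack $[L,R]$ is a pair of stacks (left and right) of integers; a pile is a stack of twinstacks. Reversing a twinstack swaps $L$ and $R$; welding down puts the left (right) stack of the top twinstack on top of the left (right) stack of the second one, making one twinstack of the two. The algorithm Rosenstiehl–Tarjan-Modified keeps an output list $O$, a pile $P$ and an input list $I$; initially $O$ and $P$ are empty and $I=\pi(1),\dots,\pi(n)$. While $I$ is nonempty it performs the following three steps. 1. *FromInput*: remove the first element $x$ of $I$ and add the twinstack $[x,-]$ to the top of $P$. 2. *Normalize*: if $P$ has only one twinstack, succeed. Otherwise let $x$ be the top element of the left stack of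 the top twinstack, and let $S=[L,R]$ be the second twinstack. - If $R\neq\emptyset$ and $x$ is smaller than both top elements of $S$, succeed. - If $R\neq\emptyset$ and $x$ is between the two top elements of $S$, weld down and succeed. - If $R\neq\emptyset$ and $x$ is larger than both top elements of $S$, the whole algorithm stops and returns false. - If $R=\emptyset$ and $x$ is smaller than the top element of $L$, succeed. - If $R=\emptyset$ and $x$ is larger than the top element of $L$: if $S$ is the bottom twinstack and $x$ is larger than every element of $S$, move $x$ to the bottom of the stack $L$, reverse what remains of the top twinstack, weld it down, and succeed; otherwise reverse $S$, weld down, and repeat Normalize. 3. *ToOutput*: let $m$ be one more than the last element of $O$ ($m=1$ if $O$ is empty). If $P$ is empty, stop this step. - If the top element of the right stack of the top twinstack is $m$, move it to the end of $O$ and reverse the top twinstack if necessary so that its largest top element is on the left stack. If moreover this twinstack is the bottom one and is now monotonic (its left stack read from top to bottom followed by its right stack read from bottom to top is an increasing or a decreasing sequence), rearrange it so that all its elements are on the left stack, increasing from top to bottom. Repeat ToOutput. - Otherwise, if the top element of the left stack of the top twinstack is $m$, move it to the end of $O$; remove the top twinstack if it is now empty, and otherwise reverse it if necessary so that its largest top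 element is on the left stack. Repeat ToOutput. - Otherwise stop this step. When $I$ is empty the algorithm returns true. **Theorem.** For every $n$ and every permutation $\pi$ of $\{1,\dots,n\}$, the algorithm Rosenstiehl–Tarjan-Modified returns true on $\pi$ if and only if $\pi$ is sortable on a deque. -/

import Mathlib

/-! ### Sorting on a deque -/

/-- The one-line notation `π(1) π(2) … π(n)` of a permutation, with values in `{1, …, n}`. -/
def oneLine {n : ℕ} (π : Equiv.Perm (Fin n)) : List ℕ :=
  List.ofFn fun i => (π i : ℕ) + 1

/-- A state of the deque switchyard: the output list (in the order in which its elements were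
popped), the deque list (from the left end to the right end), and the input list (the elements
not yet pushed, next element first). -/
structure DequeState where
  output : List ℕ
  deque : List ℕ
  input : List ℕ

/-- The transitions of the deque switchyard, one constructor for each of the four operations. -/
inductive DequeStep : DequeState → DequeState → Prop
  /-- push the next input element onto the left end -/
  | a (O D I : List ℕ) (x : ℕ) : DequeStep ⟨O, D, x :: I⟩ ⟨O, x :: D, I⟩
  /-- push the next input element onto the right end -/
  | b (O D I : List ℕ) (x : ℕ) : DequeStep ⟨O, D, x :: I⟩ ⟨O, D ++ [x], I⟩
  /-- pop the left end to the output -/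
  | y (O D I : List ℕ) (x : ℕ) : DequeStep ⟨O, x :: D, I⟩ ⟨O ++ [x], D, I⟩
  /-- pop the right end to the output -/
  | z (O D I : List ℕ) (x : ℕ) : DequeStep ⟨O, D ++ [x], I⟩ ⟨O ++ [x], D, I⟩

/-- A run of `π`: a walk along transitions, given by the list of its states, that starts with an
empty output, an empty deque and all of `π` in the input. -/
def IsDequeRun {n : ℕ} (π : Equiv.Perm (Fin n)) (r : List DequeState) : Prop :=
  r.head? = some ⟨[], [], oneLine π⟩ ∧ r.IsChain DequeStep

/-- A run is successful if it takes `2n` steps and ends with `1, 2, …, n` in the output. -/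
def IsSuccessfulDequeRun {n : ℕ} (π : Equiv.Perm (Fin n)) (r : List DequeState) : Prop :=
  IsDequeRun π r ∧ r.length = 2 * n + 1 ∧ r.getLast? = some ⟨List.range' 1 n, [], []⟩

/-- `π` is sortable on a deque. -/
def DequeSortable {n : ℕ} (π : Equiv.Perm (Fin n)) : Prop :=
  ∃ r : List DequeState, IsSuccessfulDequeRun π r

/-! ### Twinstacks -/

/-- A pair of stacks, each listed from top to bottom. A *pile* of twinstacks is a
`List Twinstack`, listed from top to bottom. -/
structure Twinstack where
  left : List ℕ
  right : List ℕ

namespace Twinstack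

/-- Swap the two sides. -/
def reverse (t : Twinstack) : Twinstack := ⟨t.right, t.left⟩

/-- Put the twinstack `t` on top of the twinstack `s`, side by side. -/
def weld (t s : Twinstack) : Twinstack := ⟨t.left ++ s.left, t.right ++ s.right⟩

/-- Both stacks are empty. -/
def isEmpty (t : Twinstack) : Bool := t.left.isEmpty && t.right.isEmpty

/-- Reverse if necessary to put the largest top element on the left stack. -/
def orient (t : Twinstack) : Twinstack :=
  match t.left, t.right with
  | [], _ => t.reverse
  | _ :: _, [] => t
  | l :: _, r :: _ => if l < r then t.reverse else t

/-- The deque contents, read from left to right, that the twinstack represents when it is on its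
own: the bottoms of the two stacks are joined. -/
def toDeque (t : Twinstack) : List ℕ := t.left ++ t.right.reverse

/-- If the represented deque is monotonic, rearrange the twinstack so that it is one-sided, with
all elements on the left stack, increasing from top to bottom; otherwise leave it unchanged. -/
def tuck (t : Twinstack) : Twinstack :=
  if t.toDeque.Pairwise (· < ·) then ⟨t.toDeque, []⟩
  else if t.toDeque.Pairwise (· > ·) then ⟨t.toDeque.reverse, []⟩
  else t

/-- The number of elements. -/
def size (t : Twinstack) : ℕ := t.left.length + t.right.length

theorem size_orient (t : Twinstack) : t.orient.size = t.size := by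
  unfold orient
  split
  · simp [reverse, size, Nat.add_comm]
  · rfl
  · split
    · simp [reverse, size, Nat.add_comm]
    · rfl

theorem size_tuck (t : Twinstack) : t.tuck.size = t.size := by
  unfold tuck
  split
  · simp [toDeque, size]
  · split
    · simp [toDeque, size, Nat.add_comm]
    · rfl

end Twinstack

/-! ### The modified Rosenstiehl–Tarjan algorithm -/

namespace RTM

/-- The subroutine `FromInput`: the new element forms a twinstack on top of the pile. -/
def fromInput (x : ℕ) (P : List Twinstack) : List Twinstack := ⟨[x], []⟩ :: P

/-- The subroutine `Normalize`. The value `none` means that it returns false, and `some P` that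
it returns true and leaves the pile `P`. It is only called on piles in which every twinstack has
a nonempty left stack, so the branches with an empty left stack are never reached. -/
def normalize : List Twinstack → Option (List Twinstack)
  | [] => some []
  | [t] => some [t]
  | ⟨[], R⟩ :: s :: P => some (⟨[], R⟩ :: s :: P)
  | t :: ⟨[], R'⟩ :: P => some (t :: ⟨[], R'⟩ :: P)
  | ⟨x :: L, R⟩ :: ⟨l :: L', r :: R'⟩ :: P =>
      if x < l ∧ x < r then some (⟨x :: L, R⟩ :: ⟨l :: L', r :: R'⟩ :: P)
      else if l < x ∧ r < x then none
      else some (Twinstack.weld ⟨x :: L, R⟩ ⟨l :: L', r :: R'⟩ :: P)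
  | ⟨x :: L, R⟩ :: ⟨l :: L', []⟩ :: P =>
      if x < l then some (⟨x :: L, R⟩ :: ⟨l :: L', []⟩ :: P)
      else if P = [] ∧ ∀ e ∈ l :: L', e < x then
        -- the second twinstack is the bottom one: move `x` to the bottom of its nonempty side,
        -- then reverse what is left of the top twinstack and weld it down
        some [(Twinstack.reverse ⟨L, R⟩).weld ⟨(l :: L') ++ [x], []⟩]
      else
        normalize (Twinstack.weld ⟨x :: L, R⟩ (Twinstack.reverse ⟨l :: L', []⟩) :: P)
  termination_by P => P.length

/-- The number of elements on a pile. -/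
def pileSize (P : List Twinstack) : ℕ := (P.map Twinstack.size).sum

/-- The next element required by the output: one more than the last element of the output, and
`1` if the output is empty. -/
def nextOut (O : List ℕ) : ℕ := O.getLastD 0 + 1

/-- The top twinstack after a pop from its right stack; `rest` is the pile below it, so the
twinstack is the bottom one if `rest` is empty. -/
def afterRightPop (t : Twinstack) (rest : List Twinstack) : Twinstack :=
  if rest = [] then t.orient.tuck else t.orient

theorem size_afterRightPop (t : Twinstack) (rest : List Twinstack) :
    (afterRightPop t rest).size = t.size := by
  unfold afterRightPop
  split
  · rw [Twinstack.size_tuck, Twinstack.size_orient]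
  · rw [Twinstack.size_orient]

/-- The pile after a pop from the left stack of its top twinstack: the top twinstack is removed
if it is now empty, and otherwise reversed if necessary. -/
def afterLeftPop (t : Twinstack) (rest : List Twinstack) : List Twinstack :=
  if t.isEmpty then rest else t.orient :: rest

theorem pileSize_afterLeftPop (t : Twinstack) (rest : List Twinstack) :
    pileSize (afterLeftPop t rest) ≤ pileSize (t :: rest) := by
  unfold afterLeftPop
  split
  · simp [pileSize]
  · simp [pileSize, Twinstack.size_orient]

/-- The subroutine `ToOutput`: move elements from the top of the pile to the output as long as
the next element required by the output is at the top of a stack of the top twinstack. -/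
def toOutput (O : List ℕ) (P : List Twinstack) : List ℕ × List Twinstack :=
  match P with
  | [] => (O, [])
  | t :: rest =>
    if hr : t.right.head? = some (nextOut O) then
      toOutput (O ++ [nextOut O]) (afterRightPop ⟨t.left, t.right.tail⟩ rest :: rest)
    else if hl : t.left.head? = some (nextOut O) then
      toOutput (O ++ [nextOut O]) (afterLeftPop ⟨t.left.tail, t.right⟩ rest)
    else (O, t :: rest)
  termination_by pileSize P
  decreasing_by
  · obtain ⟨R, hR⟩ := List.head?_eq_some_iff.mp hr
    simp only [pileSize, List.map_cons, List.sum_cons, size_afterRightPop]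
    simp [Twinstack.size, hR]
  · obtain ⟨L, hL⟩ := List.head?_eq_some_iff.mp hl
    refine lt_of_le_of_lt (pileSize_afterLeftPop _ _) ?_
    simp [pileSize, Twinstack.size, hL]

/-- The main loop, on output `O`, pile `P` and the given input. -/
def run (O : List ℕ) (P : List Twinstack) : List ℕ → Bool
  | [] => true
  | x :: I =>
    match normalize (fromInput x P) with
    | none => false
    | some P' => run (toOutput O P').1 (toOutput O P').2 I

end RTM

/-- The algorithm Rosenstiehl–Tarjan–Modified on the permutation `π`: it starts with an empty
output, an empty pile, and `π` in the input. -/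
def rosenstiehlTarjanModified {n : ℕ} (π : Equiv.Perm (Fin n)) : Bool :=
  RTM.run [] [] (oneLine π)

/-! A pile encodes a family of deque contents: flip each twinstack independently, weld them all
together and join the two bottoms (`DequeRep`). The proof maintains that the rest of the algorithm
returns true exactly when some represented deque can be completed with the remaining input
(`run_eq_true_iff`). Three facts carry this invariant.

Output can be greedy. If the next element to be output lies in the deque, removing it at once does
no harm (`Sorts.erase`). By `PileInv`, if that element is on the pile, it is on top of a stack of
the top twinstack, hence an end of every represented deque. So `toOutput` preserves completability
in both directions (`toOutput_spec`).

Input loses nothing. The family is closed under reversal, so only pushes of `x` on the left need be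
considered. A completable deque has no valley (`Sorts.noValley`), so only those `D` matter for which
`x :: D` has none. `normalize_fromInput` shows that the new pile represents all of these, represents
only results of pushing `x`, and that failure occurs only if there are none. If some pile element
exceeds `x`, the condition says that `x` lies below the whole left stack, which decides orientations
from the top of the pile down. If `x` is a new maximum, `D` must be decreasing. Tucking the bottom
twinstack makes this possible only for a one-sided pile.

When the input is exhausted, a represented deque consists of two increasing stacks, and these can
always be emptied in order (`Sorts.of_increasing_stacks`). -/

/-! ### Sortability as an inductive predicate -/

/-- `Sorts m D I`: from deque `D` and input `I` the switchyard can output `m, m + 1, …` until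
deque and input are empty. -/
inductive Sorts : ℕ → List ℕ → List ℕ → Prop
  | nil (m : ℕ) : Sorts m [] []
  | a {m : ℕ} {D I : List ℕ} {x : ℕ} : Sorts m (x :: D) I → Sorts m D (x :: I)
  | b {m : ℕ} {D I : List ℕ} {x : ℕ} : Sorts m (D ++ [x]) I → Sorts m D (x :: I)
  | y {m : ℕ} {D I : List ℕ} : Sorts (m + 1) D I → Sorts m (m :: D) I
  | z {m : ℕ} {D I : List ℕ} : Sorts (m + 1) D I → Sorts m (D ++ [m]) I

namespace Sorts

theorem exists_chain {m : ℕ} {D I : List ℕ} (h : Sorts m D I) (O : List ℕ) :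
    ∃ r : List DequeState, (⟨O, D, I⟩ :: r).IsChain DequeStep ∧
      r.length = 2 * I.length + D.length ∧
      (⟨O, D, I⟩ :: r).getLast? = some ⟨O ++ List.range' m (I.length + D.length), [], []⟩ := by
  induction h generalizing O with
  | nil m => exact ⟨[], by simp⟩
  | @a m D I x _ ih =>
    obtain ⟨r, h1, h2, h3⟩ := ih O
    refine ⟨_ :: r, h1.cons_cons (.a O D I x), ?_, ?_⟩
    · simp [h2]; ring
    · rw [List.getLast?_cons_cons, h3]; simp; ring_nf
  | @b m D I x _ ih =>
    obtain ⟨r, h1, h2, h3⟩ := ih O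
    refine ⟨_ :: r, h1.cons_cons (.b O D I x), ?_, ?_⟩
    · simp [h2]; ring
    · rw [List.getLast?_cons_cons, h3]; simp; ring_nf
  | @y m D I _ ih =>
    obtain ⟨r, h1, h2, h3⟩ := ih (O ++ [m])
    refine ⟨_ :: r, h1.cons_cons (.y O D I m), ?_, ?_⟩
    · simp [h2]; ring
    · rw [List.getLast?_cons_cons, h3]; simp [← add_assoc, List.range'_succ]
  | @z m D I _ ih =>
    obtain ⟨r, h1, h2, h3⟩ := ih (O ++ [m])
    refine ⟨_ :: r, h1.cons_cons (.z O D I m), ?_, ?_⟩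
    · simp [h2]; ring
    · rw [List.getLast?_cons_cons, h3]; simp [← add_assoc, List.range'_succ]

theorem eq_of_append_singleton_eq_range' {O : List ℕ} {x k : ℕ}
    (h : O ++ [x] = List.range' 1 k) : O = List.range' 1 (x - 1) ∧ 1 ≤ x := by
  cases k with
  | zero => simp at h
  | succ k =>
    rw [List.range'_concat] at h
    obtain ⟨rfl, h2⟩ := List.append_inj' h rfl
    simp only [List.cons.injEq, and_true] at h2
    subst h2
    simp

/-- Since the final output is `1, …, n` and elements are only appended, every earlier output is an
initial segment. This identifies each popped element as the next one required. -/
theorem of_chain {n : ℕ} (s : DequeState) (r : List DequeState)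
    (hc : (s :: r).IsChain DequeStep)
    (hl : (s :: r).getLast? = some ⟨List.range' 1 n, [], []⟩) :
    ∃ k, s.output = List.range' 1 k ∧ Sorts (k + 1) s.deque s.input := by
  induction r generalizing s with
  | nil =>
    simp at hl
    subst hl
    exact ⟨n, rfl, .nil _⟩
  | cons t r ih =>
    rw [List.isChain_cons_cons] at hc
    rw [List.getLast?_cons_cons] at hl
    obtain ⟨k, h1, h2⟩ := ih t hc.2 hl
    cases hc.1 with
    | a O D I x => exact ⟨k, h1, h2.a⟩
    | b O D I x => exact ⟨k, h1, h2.b⟩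
    | y O D I x =>
      obtain ⟨h3, h4⟩ := eq_of_append_singleton_eq_range' h1
      have h5 := congrArg List.length h1
      simp [h3] at h5
      refine ⟨x - 1, h3, ?_⟩
      have : k = x := by omega
      subst this
      have h6 : k - 1 + 1 = k := by omega
      rw [h6]
      exact h2.y
    | z O D I x =>
      obtain ⟨h3, h4⟩ := eq_of_append_singleton_eq_range' h1
      have h5 := congrArg List.length h1
      simp [h3] at h5
      refine ⟨x - 1, h3, ?_⟩
      have : k = x := by omega
      subst this
      have h6 : k - 1 + 1 = k := by omega
      rw [h6]
      exact h2.z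

end Sorts

theorem dequeSortable_iff_sorts {n : ℕ} (π : Equiv.Perm (Fin n)) :
    DequeSortable π ↔ Sorts 1 [] (oneLine π) := by
  constructor
  · rintro ⟨r, ⟨hh, hc⟩, -, hl⟩
    obtain ⟨r, rfl⟩ := List.head?_eq_some_iff.mp hh
    obtain ⟨k, h1, h2⟩ := Sorts.of_chain _ r hc hl
    have : k = 0 := by simpa using (congrArg List.length h1).symm
    subst this
    exact h2
  · intro h
    obtain ⟨r, h1, h2, h3⟩ := h.exists_chain []
    exact ⟨_ :: r, ⟨rfl, h1⟩, by simp [h2, oneLine], by simpa [oneLine] using h3⟩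

/-! ### Valleys, reflection and greedy output -/

/-- No entry of the list lies strictly below both an earlier and a later entry. -/
def NoValley (D : List ℕ) : Prop := ∀ a b c, [a, b, c].Sublist D → b < a → b < c → False

theorem NoValley.of_sublist {D E : List ℕ} (h : NoValley D) (hs : E.Sublist D) : NoValley E :=
  fun a b c habc => h a b c (habc.trans hs)

theorem NoValley.reverse {D : List ℕ} (h : NoValley D) : NoValley D.reverse := by
  intro a b c hs h1 h2
  exact h c b a (by simpa using hs.reverse) h2 h1

theorem NoValley.cons_of_forall_le {D : List ℕ} {m : ℕ} (h : NoValley D) (hm : ∀ e ∈ D, m ≤ e) :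
    NoValley (m :: D) := by
  intro a b c hs h1 h2
  rcases List.sublist_cons_iff.mp hs with hs | ⟨r, hr, hs⟩
  · exact h a b c hs h1 h2
  · simp only [List.cons.injEq] at hr
    obtain ⟨rfl, rfl⟩ := hr
    exact absurd (hm b (hs.subset (by simp))) (by omega)

namespace Sorts

theorem perm {m : ℕ} {D I : List ℕ} (h : Sorts m D I) :
    (D ++ I).Perm (List.range' m (D.length + I.length)) := by
  induction h with
  | nil m => simp
  | @a m D I x _ ih =>
    refine List.perm_middle.trans (ih.trans (List.Perm.of_eq ?_))
    simp; ring_nf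
  | @b m D I x _ ih =>
    simp only [List.append_assoc, List.singleton_append] at ih
    refine ih.trans (List.Perm.of_eq ?_)
    simp; ring_nf
  | @y m D I _ ih =>
    simp only [List.cons_append, List.length_cons]
    rw [Nat.add_right_comm, List.range'_succ]
    exact ih.cons m
  | @z m D I _ ih =>
    simp only [List.append_assoc, List.singleton_append, List.length_append, List.length_singleton]
    rw [Nat.add_right_comm, List.range'_succ]
    exact List.perm_middle.trans (ih.cons m)

theorem le_of_mem {m : ℕ} {D I : List ℕ} (h : Sorts m D I) {e : ℕ} (he : e ∈ D ++ I) : m ≤ e := by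
  have := h.perm.subset he
  simp at this
  omega

theorem nodup {m : ℕ} {D I : List ℕ} (h : Sorts m D I) : (D ++ I).Nodup :=
  h.perm.nodup_iff.mpr List.nodup_range'

theorem reverse {m : ℕ} {D I : List ℕ} (h : Sorts m D I) : Sorts m D.reverse I := by
  induction h with
  | nil m => exact .nil m
  | a _ ih => exact .b (by simpa using ih)
  | b _ ih => exact .a (by simpa using ih)
  | y _ ih => simpa using ih.z
  | z _ ih => simpa using ih.y

/-- A valley would have to leave before both of its larger neighbours, which block it on either
side. In the induction, a push passes to a sublist, and a pop concerns a minimum at an end, which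
cannot be the bottom of a valley and creates none. -/
theorem noValley {m : ℕ} {D I : List ℕ} (h : Sorts m D I) : NoValley D := by
  induction h with
  | nil m => intro a b c hs; simp at hs
  | a _ ih => exact ih.of_sublist (List.sublist_cons_self _ _)
  | b _ ih => exact ih.of_sublist (List.sublist_append_left _ _)
  | @y m D I h ih =>
    exact ih.cons_of_forall_le fun e he => by
      have := h.le_of_mem (List.mem_append_left I he); omega
  | @z m D I h ih =>
    have := (ih.reverse.cons_of_forall_le (m := m) fun e he => by
      have := h.le_of_mem (List.mem_append_left I (List.mem_reverse.mp he)); omega).reverse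
    simpa using this

/-- The next element to be output may leave the deque at once. -/
theorem erase {m : ℕ} {D I : List ℕ} (h : Sorts m D I) (hm : m ∈ D) :
    Sorts (m + 1) (D.erase m) I := by
  -- The removal of `m` is moved forward past the pushes, which only touch the outside of `D`. The
  -- first pop of the run must be that of `m` itself.
  induction h with
  | nil m => simp at hm
  | @a m D I x h ih =>
    have hx : x ≠ m := by
      rintro rfl
      exact (List.nodup_cons.mp h.nodup).1 (by simp [hm])
    have := ih (by simp [hm])
    rw [List.erase_cons_tail (by simpa using hx)] at this
    exact this.a
  | @b m D I x h ih =>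
    have := ih (by simp [hm])
    rw [List.erase_append_left _ hm] at this
    exact this.b
  | @y m D I h ih => simpa using h
  | @z m D I h ih =>
    have hD : m ∉ D := fun hD => by
      have := h.le_of_mem (List.mem_append_left I hD); omega
    rw [List.erase_append_right _ hD]
    simpa using h

theorem cons_self_iff {m : ℕ} {D I : List ℕ} : Sorts m (m :: D) I ↔ Sorts (m + 1) D I :=
  ⟨fun h => by simpa using h.erase (by simp), .y⟩

theorem append_self_iff {m : ℕ} {D I : List ℕ} : Sorts m (D ++ [m]) I ↔ Sorts (m + 1) D I := by
  refine ⟨fun h => ?_, .z⟩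
  have := h.reverse
  simp only [List.reverse_append, List.reverse_singleton, List.singleton_append] at this
  simpa using (cons_self_iff.mp this).reverse

/-- Pops are ruled out because `m` is still in the input, so the next operation is one of the two
pushes. -/
theorem cons_input_iff {m : ℕ} {D I : List ℕ} {x : ℕ} (hm : m ∉ D) :
    Sorts m D (x :: I) ↔ Sorts m (x :: D) I ∨ Sorts m (D ++ [x]) I := by
  constructor
  · intro h
    generalize hJ : x :: I = J at h
    cases h with
    | nil => simp at hJ
    | a h => cases hJ; exact .inl h
    | b h => cases hJ; exact .inr h
    | y h => simp at hm
    | z h => simp at hm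
  · rintro (h | h)
    · exact h.a
    · exact h.b

/-- The minimum of two increasing stacks is on top of one of them, so it is always at an end of the
deque. This settles the moment when the input runs out. -/
theorem of_increasing_stacks {k m : ℕ} {L R : List ℕ} (hL : L.Pairwise (· < ·))
    (hR : R.Pairwise (· < ·)) (hp : (L ++ R).Perm (List.range' m k)) :
    Sorts m (L ++ R.reverse) [] := by
  induction k generalizing m L R with
  | zero =>
    have := List.Perm.eq_nil hp
    simp at this
    simp [this, Sorts.nil]
  | succ k ih =>
    have hmem : m ∈ L ++ R := hp.symm.subset (by simp)
    have hle : ∀ e ∈ L ++ R, m ≤ e := fun e he => by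
      have := hp.subset he
      simp at this; omega
    rw [List.range'_succ] at hp
    rcases List.mem_append.mp hmem with hm | hm
    · cases L with
      | nil => simp at hm
      | cons l L =>
        have hl : l = m := by
          rcases List.mem_cons.mp hm with h | h
          · exact h.symm
          · have h1 := List.rel_of_pairwise_cons hL h
            have h2 := hle l (by simp)
            omega
        subst hl
        exact (ih hL.of_cons hR (List.Perm.cons_inv hp)).y
    · cases R with
      | nil => simp at hm
      | cons r R =>
        have hr : r = m := by
          rcases List.mem_cons.mp hm with h | h
          · exact h.symm
          · have h1 := List.rel_of_pairwise_cons hR h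
            have h2 := hle r (by simp)
            omega
        subst hr
        have := (ih hL hR.of_cons (List.Perm.cons_inv (List.perm_middle.symm.trans hp))).z
        simpa using this

end Sorts

/-! ### Piles, their invariant and the deques they represent -/

namespace Twinstack

/-- The elements of a twinstack. -/
def elems (t : Twinstack) : List ℕ := t.left ++ t.right

/-- Both stacks increase from top to bottom, the left stack is nonempty, and its top is the
largest of the tops. -/
structure Ordered (t : Twinstack) : Prop where
  left_ne_nil : t.left ≠ []
  left_increasing : t.left.Pairwise (· < ·)
  right_increasing : t.right.Pairwise (· < ·)
  top_le : ∀ l ∈ t.left.head?, ∀ r ∈ t.right.head?, r ≤ l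

/-- If the twinstack is two-sided, the deque it represents is not monotonic. -/
def Tucked (t : Twinstack) : Prop :=
  t.right ≠ [] → ¬ t.toDeque.Pairwise (· < ·) ∧ ¬ t.toDeque.Pairwise (· > ·)

end Twinstack

/-- The elements of a pile. -/
def pileElems (P : List Twinstack) : List ℕ := P.flatMap Twinstack.elems

@[simp] theorem pileElems_nil : pileElems [] = [] := rfl

@[simp] theorem pileElems_cons (t : Twinstack) (P : List Twinstack) :
    pileElems (t :: P) = t.elems ++ pileElems P := rfl

/-- The invariant of the piles between two rounds of the algorithm. -/
def PileInv : List Twinstack → Prop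
  | [] => True
  | t :: P => t.Ordered ∧ (∀ e ∈ t.elems, ∀ f ∈ pileElems P, e < f) ∧ (P = [] → t.Tucked) ∧ PileInv P

/-- `PileRep P L R`: the twinstack `[L, R]` results from reversing some of the twinstacks of the
pile `P` and then welding all of them together. -/
inductive PileRep : List Twinstack → List ℕ → List ℕ → Prop
  | nil : PileRep [] [] []
  | keep {P : List Twinstack} {L R : List ℕ} (t : Twinstack) :
      PileRep P L R → PileRep (t :: P) (t.left ++ L) (t.right ++ R)
  | flip {P : List Twinstack} {L R : List ℕ} (t : Twinstack) :
      PileRep P L R → PileRep (t :: P) (t.right ++ L) (t.left ++ R)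

namespace PileRep

theorem nil_iff {A B : List ℕ} : PileRep [] A B ↔ A = [] ∧ B = [] := by
  constructor
  · rintro ⟨⟩; simp
  · rintro ⟨rfl, rfl⟩; exact .nil

theorem cons_iff {t : Twinstack} {P : List Twinstack} {A B : List ℕ} :
    PileRep (t :: P) A B ↔ ∃ L R, PileRep P L R ∧
      ((A = t.left ++ L ∧ B = t.right ++ R) ∨ (A = t.right ++ L ∧ B = t.left ++ R)) := by
  constructor
  · intro h
    cases h with
    | keep _ h => exact ⟨_, _, h, .inl ⟨rfl, rfl⟩⟩
    | flip _ h => exact ⟨_, _, h, .inr ⟨rfl, rfl⟩⟩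
  · rintro ⟨L, R, h, ⟨rfl, rfl⟩ | ⟨rfl, rfl⟩⟩
    · exact h.keep t
    · exact h.flip t

theorem swap {P : List Twinstack} {L R : List ℕ} (h : PileRep P L R) : PileRep P R L := by
  induction h with
  | nil => exact .nil
  | keep t _ ih => exact ih.flip t
  | flip t _ ih => exact ih.keep t

theorem perm {P : List Twinstack} {L R : List ℕ} (h : PileRep P L R) :
    (L ++ R).Perm (pileElems P) := by
  induction h with
  | nil => simp
  | keep t _ ih =>
    refine List.Perm.trans ?_ (ih.append_left t.elems)
    rw [← Multiset.coe_eq_coe]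
    simp only [← Multiset.coe_add, Twinstack.elems]
    abel
  | flip t _ ih =>
    refine List.Perm.trans ?_ (ih.append_left t.elems)
    rw [← Multiset.coe_eq_coe]
    simp only [← Multiset.coe_add, Twinstack.elems]
    abel

theorem mem_of_mem_left {P : List Twinstack} {L R : List ℕ} (h : PileRep P L R) {e : ℕ} (he : e ∈ L) :
    e ∈ pileElems P :=
  h.perm.subset (by simp [he])

theorem mem_of_mem_right {P : List Twinstack} {L R : List ℕ} (h : PileRep P L R) {e : ℕ} (he : e ∈ R) :
    e ∈ pileElems P :=
  h.perm.subset (by simp [he])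

theorem exists_rep (P : List Twinstack) : ∃ L R, PileRep P L R := by
  induction P with
  | nil => exact ⟨_, _, .nil⟩
  | cons t P ih =>
    obtain ⟨L, R, h⟩ := ih
    exact ⟨_, _, h.keep t⟩

/-- Elements higher in the pile are smaller, so stacking increasing sides keeps them increasing,
whichever way each twinstack is turned. -/
theorem increasing {P : List Twinstack} {L R : List ℕ} (h : PileRep P L R) (hP : PileInv P) :
    L.Pairwise (· < ·) ∧ R.Pairwise (· < ·) := by
  induction h with
  | nil => simp
  | keep t h ih =>
    obtain ⟨h1, h2, -, h4⟩ := hP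
    obtain ⟨ih1, ih2⟩ := ih h4
    refine ⟨List.pairwise_append.mpr ⟨h1.left_increasing, ih1, fun a ha b hb => ?_⟩,
      List.pairwise_append.mpr ⟨h1.right_increasing, ih2, fun a ha b hb => ?_⟩⟩
    · exact h2 a (List.mem_append_left _ ha) b (h.mem_of_mem_left hb)
    · exact h2 a (List.mem_append_right _ ha) b (h.mem_of_mem_right hb)
  | flip t h ih =>
    obtain ⟨h1, h2, -, h4⟩ := hP
    obtain ⟨ih1, ih2⟩ := ih h4
    refine ⟨List.pairwise_append.mpr ⟨h1.right_increasing, ih1, fun a ha b hb => ?_⟩,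
      List.pairwise_append.mpr ⟨h1.left_increasing, ih2, fun a ha b hb => ?_⟩⟩
    · exact h2 a (List.mem_append_right _ ha) b (h.mem_of_mem_left hb)
    · exact h2 a (List.mem_append_left _ ha) b (h.mem_of_mem_right hb)

end PileRep

/-- `DequeRep P D`: the deque contents `D` is one of those that the pile `P` represents. -/
def DequeRep (P : List Twinstack) (D : List ℕ) : Prop := ∃ L R, PileRep P L R ∧ D = L ++ R.reverse

theorem DequeRep.reverse {P : List Twinstack} {D : List ℕ} (h : DequeRep P D) :
    DequeRep P D.reverse := by
  obtain ⟨L, R, h, rfl⟩ := h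
  exact ⟨R, L, h.swap, by simp⟩

theorem DequeRep.perm {P : List Twinstack} {D : List ℕ} (h : DequeRep P D) :
    D.Perm (pileElems P) := by
  obtain ⟨L, R, h, rfl⟩ := h
  exact ((List.reverse_perm R).append_left L).trans h.perm

/-! ### Normalize -/

/-- All elements of the left stacks, from the top of the pile to its bottom. -/
def leftElems (P : List Twinstack) : List ℕ := P.flatMap Twinstack.left

/-- Every twinstack of the pile has an empty right stack. -/
def OneSided (P : List Twinstack) : Prop := ∀ t ∈ P, t.right = []

theorem OneSided.rep {P : List Twinstack} (h : OneSided P) : PileRep P (leftElems P) [] := by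
  induction P with
  | nil => exact .nil
  | cons t P ih =>
    have h1 := (ih fun s hs => h s (by simp [hs])).keep t
    rw [h t (by simp)] at h1
    exact h1

/-- A twinstack above the bottom has smaller elements than those it encloses, so in a decreasing
deque it can contribute nothing on the left; its nonempty side goes to the right and its other side
is empty. For the bottom twinstack the claim is what `Tucked` provides. -/
theorem oneSided_of_decreasing {P : List Twinstack} {D : List ℕ} (hP : PileInv P)
    (h : DequeRep P D) (hD : D.Pairwise (· > ·)) : OneSided P := by
  induction P generalizing D with
  | nil => simp [OneSided]
  | cons t P ih =>
    obtain ⟨h1, h2, h3, h4⟩ := hP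
    obtain ⟨A, B, hAB, rfl⟩ := h
    obtain ⟨L, R, hLR, hor⟩ := PileRep.cons_iff.mp hAB
    have hD' : DequeRep P (L ++ R.reverse) := ⟨L, R, hLR, rfl⟩
    cases P with
    | nil =>
      obtain ⟨rfl, rfl⟩ := PileRep.nil_iff.mp hLR
      have ht : t.right = [] := by
        by_contra hne
        obtain ⟨h5, h6⟩ := h3 rfl hne
        rcases hor with ⟨rfl, rfl⟩ | ⟨rfl, rfl⟩
        · exact h6 (by simpa [Twinstack.toDeque] using hD)
        · apply h5
          rw [← List.pairwise_reverse] at hD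
          simpa [Twinstack.toDeque] using hD
      simpa [OneSided] using ht
    | cons s P =>
      obtain ⟨f, hf⟩ := List.exists_mem_of_ne_nil _ h4.1.left_ne_nil
      have hfP : f ∈ pileElems (s :: P) := by simp [Twinstack.elems, hf]
      have hfD : f ∈ L ++ R.reverse := hD'.perm.symm.subset hfP
      -- `f` from the lower pile lies in the middle block, so any element of `X` would be a smaller
      -- entry standing before it.
      have key : ∀ X Y : List ℕ, (X ++ (L ++ R.reverse) ++ Y).Pairwise (· > ·) →
          (∀ e ∈ X, e ∈ t.elems) → X = [] ∧ (L ++ R.reverse).Pairwise (· > ·) := by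
        intro X Y hp hX
        rw [List.pairwise_append, List.pairwise_append] at hp
        refine ⟨List.eq_nil_iff_forall_not_mem.mpr fun e he => ?_, hp.1.2.1⟩
        have := hp.1.2.2 e he f hfD
        have := h2 e (hX e he) f hfP
        omega
      rcases hor with ⟨rfl, rfl⟩ | ⟨rfl, rfl⟩
      · exact absurd (key t.left t.right.reverse (by simpa using hD)
          (fun e he => by simp [Twinstack.elems, he])).1 h1.left_ne_nil
      · obtain ⟨h5, h6⟩ := key t.right t.left.reverse (by simpa using hD)
          (fun e he => by simp [Twinstack.elems, he])
        have h7 := ih h4 hD' h6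
        intro u hu
        rcases List.mem_cons.mp hu with rfl | hu
        · exact h5
        · exact h7 u hu

/-- A new maximum never stops above a twinstack. One-sided twinstacks are swept one after another
onto the side opposite `x`, until `x` slips under the bottom one; the first two-sided twinstack met
causes failure. -/
theorem normalize_of_forall_lt {P : List Twinstack} {R : List ℕ} {x : ℕ} (hP : PileInv P)
    (hne : P ≠ []) (hx : ∀ e ∈ pileElems P, e < x) :
    (OneSided P → RTM.normalize (⟨[x], R⟩ :: P) = some [⟨R ++ leftElems P ++ [x], []⟩]) ∧
    (¬ OneSided P → RTM.normalize (⟨[x], R⟩ :: P) = none) := by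
  induction P generalizing R with
  | nil => exact absurd rfl hne
  | cons s P ih =>
    obtain ⟨h1, h2, h3, h4⟩ := hP
    obtain ⟨_ | ⟨l, L⟩, _ | ⟨r, R'⟩⟩ := s
    · exact absurd rfl h1.left_ne_nil
    · exact absurd rfl h1.left_ne_nil
    · have hl : l < x := hx l (by simp [Twinstack.elems])
      rw [RTM.normalize, if_neg (by omega)]
      by_cases hPn : P = []
      · subst hPn
        rw [if_pos ⟨rfl, fun e he => hx e (by simpa [Twinstack.elems] using he)⟩]
        simp [OneSided, leftElems, Twinstack.weld, Twinstack.reverse]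
      · rw [if_neg (by simp [hPn])]
        have := ih (R := R ++ l :: L) h4 hPn (fun e he => hx e (by simp [he]))
        simpa [OneSided, leftElems, Twinstack.weld, Twinstack.reverse] using this
    · have hl : l < x := hx l (by simp [Twinstack.elems])
      have hr : r < x := hx r (by simp [Twinstack.elems])
      rw [RTM.normalize, if_neg (by omega), if_pos ⟨hl, hr⟩]
      simp [OneSided]

/-- The pile `P'` represents exactly the results of putting `x` and the stack `R`, on opposite
sides, on top of the twinstacks that `P` represents, as far as these results consist of
increasing stacks. -/
structure PushedOn (x : ℕ) (R : List ℕ) (P P' : List Twinstack) : Prop where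
  inv : PileInv P'
  sound : ∀ A B, PileRep P' A B → ∃ L R', PileRep P L R' ∧
    ((A = x :: L ∧ B = R ++ R') ∨ (A = R ++ L ∧ B = x :: R'))
  complete : ∀ L R', PileRep P L R' → (∀ e ∈ L, x < e) → PileRep P' (x :: L) (R ++ R')

theorem pushedOn_cons {P : List Twinstack} {R : List ℕ} {x : ℕ} (hP : PileInv P)
    (hR : R.Pairwise (· < ·)) (hRP : ∀ e ∈ R, ∀ f ∈ pileElems P, e < f)
    (hRx : ∀ r ∈ R.head?, r < x) (hx : ∃ e ∈ R ++ pileElems P, x < e)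
    (hlt : ∀ e ∈ pileElems P, x < e) : PushedOn x R P (⟨[x], R⟩ :: P) where
  inv := by
    refine ⟨⟨by simp, by simp, hR, by simpa using fun r hr => (hRx r hr).le⟩, ?_, ?_, hP⟩
    · intro e he f hf
      rcases List.mem_cons.mp he with rfl | he
      · exact hlt f hf
      · exact hRP e he f hf
    -- At the bottom of the pile, the entry `e` of `R` above `x` and the top `r` of `R` below `x`
    -- refute monotonicity in the two directions.
    · rintro rfl hne
      obtain ⟨r, R, rfl⟩ := List.exists_cons_of_ne_nil hne
      obtain ⟨e, he, hxe⟩ := hx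
      have hrx : r < x := hRx r (by simp)
      simp only [pileElems_nil, List.append_nil] at he
      constructor
      · intro h
        have := List.rel_of_pairwise_cons h (a' := r) (by simp)
        omega
      · intro h
        have := List.rel_of_pairwise_cons h (a' := e) (by simpa [or_comm] using he)
        omega
  sound A B h := PileRep.cons_iff.mp h
  complete L R' h _ := h.keep ⟨[x], R⟩

/-- With `r < x < l`, only the orientation having `l` under `x` keeps the stacks increasing, so
welding discards no admissible deque. -/
theorem pushedOn_weld {P : List Twinstack} {l r x : ℕ} {L₀ R₀ R : List ℕ}
    (hP : PileInv (⟨l :: L₀, r :: R₀⟩ :: P)) (hR : R.Pairwise (· < ·))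
    (hRP : ∀ e ∈ R, ∀ f ∈ pileElems (⟨l :: L₀, r :: R₀⟩ :: P), e < f)
    (hRx : ∀ r ∈ R.head?, r < x) (hrx : r < x) (hxl : x < l) :
    PushedOn x R (⟨l :: L₀, r :: R₀⟩ :: P)
      (Twinstack.weld ⟨[x], R⟩ ⟨l :: L₀, r :: R₀⟩ :: P) where
  inv := by
    obtain ⟨h1, h2, h3, h4⟩ := hP
    have hl := h1.left_increasing
    refine ⟨⟨by simp [Twinstack.weld], ?_, ?_, ?_⟩, ?_, ?_, h4⟩
    · refine List.pairwise_cons.mpr ⟨fun e he => ?_, hl⟩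
      rcases List.mem_cons.mp he with rfl | he
      · exact hxl
      · exact hxl.trans (List.rel_of_pairwise_cons hl he)
    · exact List.pairwise_append.mpr ⟨hR, h1.right_increasing, fun a ha b hb =>
        hRP a ha b (List.mem_append_left _ (List.mem_append_right _ hb))⟩
    · intro a ha b hb
      obtain rfl : x = a := by simpa [Twinstack.weld] using ha
      cases R with
      | nil =>
        obtain rfl : r = b := by simpa [Twinstack.weld] using hb
        exact hrx.le
      | cons c R =>
        obtain rfl : c = b := by simpa [Twinstack.weld] using hb
        exact (hRx c rfl).le
    · intro e he f hf
      simp only [Twinstack.elems, Twinstack.weld, List.mem_append] at he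
      rcases he with (he | he) | (he | he)
      · obtain rfl : e = x := by simpa using he
        exact hxl.trans (h2 l (by simp [Twinstack.elems]) f hf)
      · exact h2 e (List.mem_append_left _ he) f hf
      · exact hRP e he f (List.mem_append_right _ hf)
      · exact h2 e (List.mem_append_right _ he) f hf
    -- The deque begins with `x < l`, so it is not decreasing, and `r < l` stands further right, so
    -- it is not increasing.
    · rintro - -
      constructor
      · intro h
        have h5 := (List.pairwise_append.mp h).2.2 l (by simp [Twinstack.weld])
          r (by simp [Twinstack.weld])
        omega
      · intro h
        have h5 := List.rel_of_pairwise_cons h (a' := l) (by simp)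
        omega
  sound A B h := by
    obtain ⟨L, R', hLR, ⟨rfl, rfl⟩ | ⟨rfl, rfl⟩⟩ := PileRep.cons_iff.mp h
    · exact ⟨_, _, PileRep.keep _ hLR, .inl (by simp [Twinstack.weld])⟩
    · exact ⟨_, _, PileRep.flip _ hLR, .inr (by simp [Twinstack.weld])⟩
  complete L R' h hlt := by
    obtain ⟨L₂, R₂, hLR, ⟨rfl, rfl⟩ | ⟨rfl, rfl⟩⟩ := PileRep.cons_iff.mp h
    · simpa [Twinstack.weld] using
        hLR.keep (Twinstack.weld ⟨[x], R⟩ ⟨l :: L₀, r :: R₀⟩)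
    · have := hlt r (by simp)
      omega

theorem PileInv.lt_of_lt_tops {s : Twinstack} {P : List Twinstack} {x l : ℕ}
    (hP : PileInv (s :: P)) (hl : l ∈ s.left.head?) (hxl : x < l)
    (hr : ∀ r ∈ s.right.head?, x < r) : ∀ e ∈ pileElems (s :: P), x < e := by
  obtain ⟨h1, h2, -, -⟩ := hP
  have stack : ∀ S : List ℕ, S.Pairwise (· < ·) → (∀ a ∈ S.head?, x < a) → ∀ e ∈ S, x < e := by
    intro S hS ha e he
    cases S with
    | nil => simp at he
    | cons a S =>
      have hxa : x < a := ha a rfl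
      rcases List.mem_cons.mp he with rfl | he
      · exact hxa
      · exact hxa.trans (List.rel_of_pairwise_cons hS he)
  intro e he
  rcases List.mem_append.mp he with he | he
  · rcases List.mem_append.mp he with he | he
    · refine stack _ h1.left_increasing (fun a ha => ?_) e he
      obtain rfl : l = a := Option.mem_unique hl ha
      exact hxl
    · exact stack _ h1.right_increasing hr e he
  · exact hxl.trans (h2 l (List.mem_append_left _ (List.mem_of_mem_head? hl)) e he)

/-- What `normalize` achieves on a pile whose top twinstack is `[x, R]`, when `x` is not the
largest element. -/
theorem normalize_of_exists_gt {P : List Twinstack} {R : List ℕ} {x : ℕ} (hP : PileInv P)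
    (hR : R.Pairwise (· < ·)) (hRP : ∀ e ∈ R, ∀ f ∈ pileElems P, e < f)
    (hRx : ∀ r ∈ R.head?, r < x) (hxP : x ∉ pileElems P)
    (hx : ∃ e ∈ R ++ pileElems P, x < e) :
    (RTM.normalize (⟨[x], R⟩ :: P) = none → ∀ L R', PileRep P L R' → ¬ ∀ e ∈ L, x < e) ∧
    (∀ P', RTM.normalize (⟨[x], R⟩ :: P) = some P' → PushedOn x R P P') := by
  induction P generalizing R with
  | nil =>
    rw [RTM.normalize]
    refine ⟨by simp, ?_⟩
    rintro P' h
    obtain rfl := Option.some.inj h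
    exact pushedOn_cons hP hR hRP hRx hx (by simp)
  | cons s P ih =>
    obtain ⟨h1, h2, h3, h4⟩ := id hP
    obtain ⟨_ | ⟨l, L₀⟩, _ | ⟨r, R₀⟩⟩ := s
    · exact absurd rfl h1.left_ne_nil
    · exact absurd rfl h1.left_ne_nil
    · have hxl : x ≠ l := by rintro rfl; simp [Twinstack.elems] at hxP
      rw [RTM.normalize]
      by_cases hlt : x < l
      · rw [if_pos hlt]
        refine ⟨by simp, fun P' h => ?_⟩
        obtain rfl := Option.some.inj h
        exact pushedOn_cons hP hR hRP hRx hx (hP.lt_of_lt_tops rfl hlt (by simp))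
      -- The special clause for the bottom twinstack is reserved for a new maximum: an element above
      -- `x` lies either in this pile, or in `R` and then below `l < x`.
      · have hnb : ¬ (P = [] ∧ ∀ e ∈ l :: L₀, e < x) := by
          rintro ⟨rfl, hall⟩
          obtain ⟨e, he, hxe⟩ := hx
          rcases List.mem_append.mp he with he | he
          · have := hRP e he l (by simp [Twinstack.elems])
            omega
          · have := hall e (by simpa [Twinstack.elems] using he)
            omega
        rw [if_neg hlt, if_neg hnb]
        have hR' : (R ++ l :: L₀).Pairwise (· < ·) :=
          List.pairwise_append.mpr ⟨hR, h1.left_increasing, fun a ha b hb =>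
            hRP a ha b (List.mem_append_left _ (List.mem_append_left _ hb))⟩
        have hRP' : ∀ e ∈ R ++ l :: L₀, ∀ f ∈ pileElems P, e < f := by
          intro e he f hf
          rcases List.mem_append.mp he with he | he
          · exact hRP e he f (List.mem_append_right _ hf)
          · exact h2 e (List.mem_append_left _ he) f hf
        have hRx' : ∀ r ∈ (R ++ l :: L₀).head?, r < x := by
          cases R with
          | nil => simp; omega
          | cons c R => simpa using hRx
        -- Since `l < x`, this one-sided twinstack is forced to the side opposite `x`. Reversing and
        -- welding it therefore loses nothing, and the induction continues with `R ++ l :: L₀`.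
        have only : ∀ L R', PileRep (⟨l :: L₀, []⟩ :: P) L R' → (∀ e ∈ L, x < e) →
            ∃ R₂, PileRep P L R₂ ∧ R' = (l :: L₀) ++ R₂ := by
          intro L R' h hall
          obtain ⟨L₂, R₂, hLR, ⟨rfl, rfl⟩ | ⟨rfl, rfl⟩⟩ := PileRep.cons_iff.mp h
          · have := hall l (by simp)
            omega
          · exact ⟨R₂, hLR, rfl⟩
        obtain ⟨ih1, ih2⟩ := ih h4 hR' hRP' hRx' (fun h => hxP (List.mem_append_right _ h))
          (by simpa [Twinstack.elems] using hx)
        refine ⟨fun h L R' hLR hall => ?_, fun P' h => ?_⟩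
        · obtain ⟨R₂, h5, -⟩ := only L R' hLR hall
          exact ih1 h L R₂ h5 hall
        · obtain ⟨h5, h6, h7⟩ := ih2 P' h
          refine ⟨h5, fun A B hAB => ?_, fun L R' hLR hall => ?_⟩
          · obtain ⟨L, R', h8, ⟨rfl, rfl⟩ | ⟨rfl, rfl⟩⟩ := h6 A B hAB
            · exact ⟨_, _, h8.flip ⟨l :: L₀, []⟩, .inl (by simp)⟩
            · exact ⟨_, _, h8.keep ⟨l :: L₀, []⟩, .inr (by simp)⟩
          · obtain ⟨R₂, h8, rfl⟩ := only L R' hLR hall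
            simpa using h7 L R₂ h8 hall
    · have hxl : x ≠ l := by rintro rfl; simp [Twinstack.elems] at hxP
      have hxr : x ≠ r := by rintro rfl; simp [Twinstack.elems] at hxP
      have hrl : r ≤ l := h1.top_le l rfl r rfl
      rw [RTM.normalize]
      split_ifs with hc1 hc2
      · refine ⟨by simp, fun P' h => ?_⟩
        obtain rfl := Option.some.inj h
        exact pushedOn_cons hP hR hRP hRx hx (hP.lt_of_lt_tops rfl hc1.1 (by simpa using hc1.2))
      -- Both tops are below `x`, so either orientation puts a smaller element under `x`.
      · refine ⟨fun _ L R' h => ?_, by simp⟩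
        obtain ⟨L₂, R₂, -, ⟨rfl, -⟩ | ⟨rfl, -⟩⟩ := PileRep.cons_iff.mp h
        · intro hall
          have := hall l (by simp)
          omega
        · intro hall
          have := hall r (by simp)
          omega
      · refine ⟨by simp, fun P' h => ?_⟩
        obtain rfl := Option.some.inj h
        exact pushedOn_weld hP hR hRP hRx (by omega) (by omega)

/-- What `normalize` achieves after a new element `x` has been put on the pile. -/
theorem normalize_fromInput {P : List Twinstack} {x : ℕ} (hP : PileInv P)
    (hnd : (pileElems P).Nodup) (hxP : x ∉ pileElems P) :
    (RTM.normalize (RTM.fromInput x P) = none → ∀ D, DequeRep P D → ¬ NoValley (x :: D)) ∧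
    (∀ P', RTM.normalize (RTM.fromInput x P) = some P' → PileInv P' ∧
      (∀ D', DequeRep P' D' → ∃ D, DequeRep P D ∧ (D' = x :: D ∨ D' = D ++ [x])) ∧
      ∀ D, DequeRep P D → NoValley (x :: D) → DequeRep P' (x :: D)) := by
  unfold RTM.fromInput
  by_cases hx : ∃ e ∈ pileElems P, x < e
  · obtain ⟨h1, h2⟩ := normalize_of_exists_gt (R := []) hP (by simp) (by simp) (by simp) hxP
      (by simpa using hx)
    -- If `e < x` lay on the left stack, some `c > x` would come after it, deeper in that increasing
    -- stack or on the right one, and `x, e, c` would be a valley.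
    have tops : ∀ L R, PileRep P L R → NoValley (x :: (L ++ R.reverse)) → ∀ e ∈ L, x < e := by
      intro L R hLR hnv e he
      by_contra hlt
      have hex : e < x := by
        have : e ≠ x := by rintro rfl; exact hxP (hLR.mem_of_mem_left he)
        omega
      obtain ⟨c, hc, hxc⟩ := hx
      have hcD : c ∈ L ++ R := hLR.perm.symm.subset hc
      have hs : [e, c].Sublist (L ++ R.reverse) := by
        rcases List.mem_append.mp hcD with hcL | hcR
        · have hL := (hLR.increasing hP).1
          obtain ⟨A, B, rfl⟩ := List.append_of_mem he
          have : c ∈ B := by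
            rcases List.mem_append.mp hcL with h | h
            · have := (List.pairwise_append.mp hL).2.2 c h e (by simp)
              omega
            · rcases List.mem_cons.mp h with rfl | h
              · omega
              · exact h
          refine List.Sublist.trans ?_ (List.sublist_append_left _ _)
          exact List.Sublist.trans
            (List.Sublist.cons_cons e (List.singleton_sublist.mpr this))
            (List.sublist_append_right _ _)
        · exact List.Sublist.append (List.singleton_sublist.mpr he)
            (List.singleton_sublist.mpr (List.mem_reverse.mpr hcR))
      exact hnv x e c (hs.cons_cons x) hex (by omega)
    refine ⟨?_, fun P' h => ?_⟩
    · rintro h _ ⟨L, R, hLR, rfl⟩ hnv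
      exact h1 h L R hLR (tops L R hLR hnv)
    · obtain ⟨h3, h4, h5⟩ := h2 P' h
      refine ⟨h3, ?_, ?_⟩
      · rintro _ ⟨A, B, hAB, rfl⟩
        obtain ⟨L, R, hLR, ⟨rfl, rfl⟩ | ⟨rfl, rfl⟩⟩ := h4 A B hAB
        · exact ⟨_, ⟨_, _, hLR, rfl⟩, .inl (by simp)⟩
        · exact ⟨_, ⟨_, _, hLR, rfl⟩, .inr (by simp)⟩
      · rintro _ ⟨L, R, hLR, rfl⟩ hnv
        exact ⟨_, _, h5 L R hLR (tops L R hLR hnv), by simp⟩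
  · have hlt : ∀ e ∈ pileElems P, e < x := by
      intro e he
      by_contra h
      have : e ≠ x := by rintro rfl; exact hxP he
      exact hx ⟨e, he, by omega⟩
    -- Behind a leading maximum `x`, any ascent is the right half of a valley.
    have dec : ∀ D, DequeRep P D → NoValley (x :: D) → D.Pairwise (· > ·) := by
      intro D hD hnv
      rw [List.pairwise_iff_forall_sublist]
      intro b c hs
      have hbx : b < x := hlt b (hD.perm.subset (hs.subset (by simp)))
      have hbc : b ≠ c := by
        simpa using (hs.nodup (hD.perm.nodup_iff.mpr hnd))
      exact lt_of_le_of_ne (not_lt.mp (hnv x b c (hs.cons_cons x) hbx)) hbc.symm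
    by_cases hPn : P = []
    · subst hPn
      rw [RTM.normalize]
      refine ⟨by simp, fun P' h => ?_⟩
      obtain rfl := Option.some.inj h
      refine ⟨⟨⟨by simp, by simp, by simp, by simp⟩, by simp, by simp [Twinstack.Tucked], trivial⟩,
        ?_, ?_⟩
      · rintro _ ⟨A, B, hAB, rfl⟩
        obtain ⟨L, R, hLR, hor⟩ := PileRep.cons_iff.mp hAB
        obtain ⟨rfl, rfl⟩ := PileRep.nil_iff.mp hLR
        refine ⟨[], ⟨[], [], .nil, rfl⟩, .inl ?_⟩
        rcases hor with ⟨rfl, rfl⟩ | ⟨rfl, rfl⟩ <;> simp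
      · rintro _ ⟨L, R, hLR, rfl⟩ -
        obtain ⟨rfl, rfl⟩ := PileRep.nil_iff.mp hLR
        exact ⟨[x], [], PileRep.nil.keep ⟨[x], []⟩, by simp⟩
    · obtain ⟨h1, h2⟩ := normalize_of_forall_lt (R := []) hP hPn hlt
      by_cases hone : OneSided P
      · rw [h1 hone]
        refine ⟨by simp, fun P' h => ?_⟩
        obtain rfl := Option.some.inj h
        have hinc := (hone.rep.increasing hP).1
        simp only [List.nil_append]
        have hrep : ∀ A B, PileRep [⟨leftElems P ++ [x], []⟩] A B ↔
            (A = leftElems P ++ [x] ∧ B = []) ∨ (A = [] ∧ B = leftElems P ++ [x]) := by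
          simp [PileRep.cons_iff, PileRep.nil_iff]
        refine ⟨⟨⟨by simp, ?_, by simp, by simp⟩, by simp, by simp [Twinstack.Tucked], trivial⟩,
          ?_, ?_⟩
        · exact List.pairwise_append.mpr ⟨hinc, by simp, fun a ha b hb => by
            obtain rfl := List.mem_singleton.mp hb
            exact hlt a (hone.rep.mem_of_mem_left ha)⟩
        · rintro _ ⟨A, B, hAB, rfl⟩
          rcases (hrep A B).mp hAB with ⟨rfl, rfl⟩ | ⟨rfl, rfl⟩
          · exact ⟨_, ⟨_, _, hone.rep, rfl⟩, .inr (by simp)⟩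
          · exact ⟨_, ⟨_, _, hone.rep.swap, rfl⟩, .inl (by simp)⟩
        · intro D hD hnv
          -- A decreasing `D` is determined by its elements: it is the left stacks read upwards. Its
          -- push on the left is thus the mirror image of appending `x` at the bottom.
          have hDinc : D.reverse.Pairwise (· < ·) := List.pairwise_reverse.mpr (dec D hD hnv)
          have hperm : D.reverse.Perm (leftElems P) :=
            (List.reverse_perm D).trans (hD.perm.trans (by simpa using hone.rep.perm.symm))
          have heq : D.reverse = leftElems P :=
            hperm.eq_of_pairwise (fun a b _ _ h1 h2 => by omega) hDinc hinc
          exact ⟨_, _, (hrep _ _).mpr (.inr ⟨rfl, rfl⟩), by simp [← heq]⟩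
      · rw [h2 hone]
        exact ⟨fun _ D hD hnv => hone (oneSided_of_decreasing hP hD (dec D hD hnv)), by simp⟩

/-! ### ToOutput -/

theorem PileInv.head_of_mem {t : Twinstack} {P : List Twinstack} {m : ℕ} (hP : PileInv (t :: P))
    (hle : ∀ e ∈ pileElems (t :: P), m ≤ e) (hm : m ∈ pileElems (t :: P)) :
    t.right.head? = some m ∨ t.left.head? = some m := by
  obtain ⟨h1, h2, -, -⟩ := hP
  have stack : ∀ S : List ℕ, S.Pairwise (· < ·) → (∀ e ∈ S, m ≤ e) → m ∈ S →
      S.head? = some m := by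
    intro S hS hSm hmS
    cases S with
    | nil => simp at hmS
    | cons a S =>
      rcases List.mem_cons.mp hmS with rfl | h
      · rfl
      · have h3 := List.rel_of_pairwise_cons hS h
        have h4 := hSm a (by simp)
        omega
  rcases List.mem_append.mp hm with hm | hm
  · rcases List.mem_append.mp hm with hm | hm
    · exact .inr (stack _ h1.left_increasing
        (fun e he => hle e (by simp [Twinstack.elems, he])) hm)
    · exact .inl (stack _ h1.right_increasing
        (fun e he => hle e (by simp [Twinstack.elems, he])) hm)
  · obtain ⟨e, he⟩ := List.exists_mem_of_ne_nil _ h1.left_ne_nil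
    have h3 := h2 e (List.mem_append_left _ he) m hm
    have h4 := hle e (by simp [Twinstack.elems, he])
    omega

theorem Twinstack.orient_eq (t : Twinstack) : t.orient = t ∨ t.orient = t.reverse := by
  unfold Twinstack.orient
  split
  · simp
  · simp
  · split <;> simp

theorem Twinstack.ordered_orient {t : Twinstack} (hne : t.elems ≠ [])
    (hl : t.left.Pairwise (· < ·)) (hr : t.right.Pairwise (· < ·)) : t.orient.Ordered := by
  obtain ⟨_ | ⟨l, L⟩, _ | ⟨r, R⟩⟩ := t
  · simp [Twinstack.elems] at hne
  · exact ⟨by simp [orient, reverse], hr, hl, by simp [orient, reverse]⟩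
  · exact ⟨by simp [orient], hl, hr, by simp [orient]⟩
  · by_cases h : l < r
    · simp only [orient, if_pos h, reverse]
      exact ⟨by simp, hr, hl, by simpa using h.le⟩
    · simp only [orient, if_neg h]
      exact ⟨by simp, hl, hr, by simpa using h⟩

theorem dequeRep_reverse_cons (t : Twinstack) (P : List Twinstack) (D : List ℕ) :
    DequeRep (t.reverse :: P) D ↔ DequeRep (t :: P) D := by
  simp only [DequeRep, PileRep.cons_iff, Twinstack.reverse]
  constructor <;> rintro ⟨A, B, ⟨L, R, h, hor⟩, rfl⟩ <;> exact ⟨A, B, ⟨L, R, h, hor.symm⟩, rfl⟩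

theorem dequeRep_orient_cons (t : Twinstack) (P : List Twinstack) (D : List ℕ) :
    DequeRep (t.orient :: P) D ↔ DequeRep (t :: P) D := by
  rcases t.orient_eq with h | h <;> rw [h]
  exact dequeRep_reverse_cons t P D

theorem dequeRep_singleton (t : Twinstack) (D : List ℕ) :
    DequeRep [t] D ↔ D = t.toDeque ∨ D = t.toDeque.reverse := by
  simp only [DequeRep, PileRep.cons_iff, PileRep.nil_iff, Twinstack.toDeque]
  constructor
  · rintro ⟨A, B, ⟨L, R, ⟨rfl, rfl⟩, ⟨rfl, rfl⟩ | ⟨rfl, rfl⟩⟩, rfl⟩ <;> simp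
  · rintro (rfl | rfl)
    · exact ⟨_, _, ⟨[], [], ⟨rfl, rfl⟩, .inl ⟨rfl, rfl⟩⟩, by simp⟩
    · exact ⟨_, _, ⟨[], [], ⟨rfl, rfl⟩, .inr ⟨rfl, rfl⟩⟩, by simp⟩

theorem dequeRep_tuck (t : Twinstack) (D : List ℕ) : DequeRep [t.tuck] D ↔ DequeRep [t] D := by
  have h : t.tuck.toDeque = t.toDeque ∨ t.tuck.toDeque = t.toDeque.reverse := by
    unfold Twinstack.tuck
    split_ifs <;> simp [Twinstack.toDeque]
  rw [dequeRep_singleton, dequeRep_singleton]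
  rcases h with h | h <;> rw [h]
  simp [or_comm]

theorem dequeRep_afterRightPop (t : Twinstack) (P : List Twinstack) (D : List ℕ) :
    DequeRep (RTM.afterRightPop t P :: P) D ↔ DequeRep (t :: P) D := by
  unfold RTM.afterRightPop
  split_ifs with h
  · subst h
    rw [dequeRep_tuck, dequeRep_orient_cons]
  · exact dequeRep_orient_cons t P D

/-- Every pile represents at least one deque, and a represented deque lists all elements of its
pile. -/
theorem DequeRep.pileElems_perm {P P' : List Twinstack}
    (h : ∀ D, DequeRep P' D ↔ DequeRep P D) : (pileElems P').Perm (pileElems P) := by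
  obtain ⟨L, R, hLR⟩ := PileRep.exists_rep P
  have h1 : DequeRep P (L ++ R.reverse) := ⟨L, R, hLR, rfl⟩
  exact ((h _).mpr h1).perm.symm.trans h1.perm

theorem Twinstack.Ordered.tuck {t : Twinstack} (h : t.Ordered) :
    t.tuck.Ordered ∧ t.tuck.Tucked := by
  have hne : t.toDeque ≠ [] := by simp [Twinstack.toDeque, h.left_ne_nil]
  unfold Twinstack.tuck
  split_ifs with h1 h2
  · exact ⟨⟨hne, h1, by simp, by simp⟩, by simp [Twinstack.Tucked]⟩
  · exact ⟨⟨by simpa using hne, List.pairwise_reverse.mpr h2, by simp, by simp⟩,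
      by simp [Twinstack.Tucked]⟩
  · exact ⟨h, fun _ => ⟨h1, h2⟩⟩

theorem PileInv.afterRightPop {t : Twinstack} {P : List Twinstack} (hne : t.elems ≠ [])
    (hl : t.left.Pairwise (· < ·)) (hr : t.right.Pairwise (· < ·))
    (hlt : ∀ e ∈ t.elems, ∀ f ∈ pileElems P, e < f) (hP : PileInv P) :
    PileInv (RTM.afterRightPop t P :: P) := by
  have h1 := Twinstack.ordered_orient hne hl hr
  by_cases hPn : P = []
  · subst hPn
    rw [RTM.afterRightPop, if_pos rfl]
    exact ⟨h1.tuck.1, by simp, fun _ => h1.tuck.2, trivial⟩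
  · rw [RTM.afterRightPop, if_neg hPn]
    refine ⟨h1, fun e he => hlt e ?_, fun h => absurd h hPn, hP⟩
    rcases t.orient_eq with h | h
    · rwa [h] at he
    · rw [h] at he
      simpa [Twinstack.elems, Twinstack.reverse, or_comm] using he

/-- A top of the top twinstack is an end of every represented deque, the right or the left one
according to orientation. Popping it there is an equivalence because output can be greedy. -/
theorem exists_sorts_pop_right {L R : List ℕ} {P : List Twinstack} {m : ℕ} {I : List ℕ} :
    (∃ D, DequeRep (⟨L, m :: R⟩ :: P) D ∧ Sorts m D I) ↔
      ∃ D, DequeRep (⟨L, R⟩ :: P) D ∧ Sorts (m + 1) D I := by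
  constructor
  · rintro ⟨_, ⟨_, _, h, rfl⟩, hs⟩
    obtain ⟨A, B, hAB, ⟨rfl, rfl⟩ | ⟨rfl, rfl⟩⟩ := PileRep.cons_iff.mp h
    · exact ⟨_, ⟨_, _, PileRep.keep ⟨L, R⟩ hAB, rfl⟩,
        Sorts.append_self_iff.mp (by simpa using hs)⟩
    · exact ⟨_, ⟨_, _, PileRep.flip ⟨L, R⟩ hAB, rfl⟩,
        Sorts.cons_self_iff.mp (by simpa using hs)⟩
  · rintro ⟨_, ⟨_, _, h, rfl⟩, hs⟩
    obtain ⟨A, B, hAB, ⟨rfl, rfl⟩ | ⟨rfl, rfl⟩⟩ := PileRep.cons_iff.mp h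
    · exact ⟨_, ⟨_, _, PileRep.keep ⟨L, m :: R⟩ hAB, rfl⟩,
        by simpa using hs.z⟩
    · exact ⟨_, ⟨_, _, PileRep.flip ⟨L, m :: R⟩ hAB, rfl⟩,
        by simpa using hs.y⟩

theorem exists_sorts_pop_left {L R : List ℕ} {P : List Twinstack} {m : ℕ} {I : List ℕ} :
    (∃ D, DequeRep (⟨m :: L, R⟩ :: P) D ∧ Sorts m D I) ↔
      ∃ D, DequeRep (⟨L, R⟩ :: P) D ∧ Sorts (m + 1) D I := by
  have h := exists_sorts_pop_right (L := R) (R := L) (P := P) (m := m) (I := I)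
  simp only [← dequeRep_reverse_cons ⟨R, m :: L⟩, ← dequeRep_reverse_cons ⟨R, L⟩] at h
  exact h

theorem dequeRep_empty_cons (P : List Twinstack) (D : List ℕ) :
    DequeRep (⟨[], []⟩ :: P) D ↔ DequeRep P D := by
  simp [DequeRep, PileRep.cons_iff]

theorem exists_perm_range'_of_cons {m k : ℕ} {X : List ℕ} (h : (m :: X).Perm (List.range' m k)) :
    ∃ k', X.Perm (List.range' (m + 1) k') := by
  cases k with
  | zero => simp at h
  | succ k =>
    rw [List.range'_succ] at h
    exact ⟨k, h.cons_inv⟩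

theorem le_of_mem_of_perm_range' {m k e : ℕ} {X Y : List ℕ}
    (h : (X ++ Y).Perm (List.range' m k)) (he : e ∈ X) : m ≤ e := by
  have := h.subset (List.mem_append_left Y he)
  simp at this
  omega

theorem nextOut_append (O : List ℕ) (m : ℕ) : RTM.nextOut (O ++ [m]) = m + 1 := by
  simp [RTM.nextOut]

/-- `toOutput` keeps the invariant, outputs everything that can be output, and does not change
whether some represented deque can be sorted. -/
theorem toOutput_spec (O : List ℕ) (P : List Twinstack) (I : List ℕ) (hP : PileInv P)
    (hperm : ∃ k, (pileElems P ++ I).Perm (List.range' (RTM.nextOut O) k)) :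
    PileInv (RTM.toOutput O P).2 ∧
    (∃ k, (pileElems (RTM.toOutput O P).2 ++ I).Perm
      (List.range' (RTM.nextOut (RTM.toOutput O P).1) k)) ∧
    RTM.nextOut (RTM.toOutput O P).1 ∉ pileElems (RTM.toOutput O P).2 ∧
    ((∃ D, DequeRep P D ∧ Sorts (RTM.nextOut O) D I) ↔
      ∃ D, DequeRep (RTM.toOutput O P).2 D ∧ Sorts (RTM.nextOut (RTM.toOutput O P).1) D I) := by
  fun_induction RTM.toOutput O P with
  | case1 O => exact ⟨hP, hperm, by simp, Iff.rfl⟩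
  | case2 O t P hr ih =>
    obtain ⟨L, R⟩ := t
    obtain ⟨R, rfl⟩ := List.head?_eq_some_iff.mp hr
    obtain ⟨h1, h2, -, h4⟩ := hP
    obtain ⟨k, hk⟩ := hperm
    rw [nextOut_append] at ih
    have hrep := dequeRep_afterRightPop ⟨L, R⟩ P
    have hk' := exists_perm_range'_of_cons (X := pileElems (⟨L, R⟩ :: P) ++ I)
      (List.Perm.trans (by simpa [Twinstack.elems] using List.perm_middle.symm) hk)
    have h5 : PileInv (RTM.afterRightPop ⟨L, R⟩ P :: P) :=
      PileInv.afterRightPop (by simpa [Twinstack.elems] using fun h => absurd h h1.left_ne_nil)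
        h1.left_increasing h1.right_increasing.of_cons
        (fun e he => h2 e (by
          simp only [Twinstack.elems, List.mem_append, List.mem_cons] at he ⊢; tauto)) h4
    obtain ⟨k', hk'⟩ := hk'
    obtain ⟨i1, i2, i3, i4⟩ := ih h5
      ⟨k', ((DequeRep.pileElems_perm hrep).append_right I).trans hk'⟩
    refine ⟨i1, i2, i3, Iff.trans ?_ i4⟩
    simp only [List.tail_cons, hrep]
    exact exists_sorts_pop_right
  | case3 O t P hr hl ih =>
    obtain ⟨L, R⟩ := t
    obtain ⟨L, rfl⟩ := List.head?_eq_some_iff.mp hl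
    obtain ⟨h1, h2, -, h4⟩ := hP
    obtain ⟨k, hk⟩ := hperm
    -- The left top is at least the right top. If it is the minimum, a nonempty right stack would
    -- have the same top and the first branch would have applied. Being one-sided, the remainder
    -- needs no tucking.
    obtain rfl : R = [] := by
      cases R with
      | nil => rfl
      | cons r R =>
        have h5 := h1.top_le _ rfl r rfl
        have h6 := le_of_mem_of_perm_range' hk (e := r) (by simp [Twinstack.elems])
        exact absurd (by simpa using le_antisymm h5 h6) hr
    rw [nextOut_append] at ih
    have hrep : ∀ D, DequeRep (RTM.afterLeftPop ⟨L, []⟩ P) D ↔ DequeRep (⟨L, []⟩ :: P) D := by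
      intro D
      unfold RTM.afterLeftPop
      cases L with
      | nil => exact (dequeRep_empty_cons P D).symm
      | cons l L => exact dequeRep_orient_cons _ P D
    have h5 : PileInv (RTM.afterLeftPop ⟨L, []⟩ P) := by
      cases L with
      | nil => exact h4
      | cons l L =>
        exact ⟨⟨by simp [Twinstack.orient], h1.left_increasing.of_cons, by simp [Twinstack.orient],
          by simp [Twinstack.orient]⟩, fun e he => h2 e (List.mem_cons_of_mem _ he),
          by simp [Twinstack.Tucked, Twinstack.orient], h4⟩
    obtain ⟨k', hk'⟩ := exists_perm_range'_of_cons (X := pileElems (⟨L, []⟩ :: P) ++ I) hk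
    obtain ⟨i1, i2, i3, i4⟩ := ih h5
      ⟨k', ((DequeRep.pileElems_perm hrep).append_right I).trans hk'⟩
    refine ⟨i1, i2, i3, Iff.trans ?_ i4⟩
    simp only [List.tail_cons, hrep]
    exact exists_sorts_pop_left
  | case4 O t P hr hl =>
    refine ⟨hP, hperm, fun hm => ?_, Iff.rfl⟩
    obtain ⟨k, hk⟩ := hperm
    rcases hP.head_of_mem (fun e he => le_of_mem_of_perm_range' hk he) hm with h | h
    · exact hr h
    · exact hl h

/-! ### Correctness -/

theorem run_eq_true_iff (I O : List ℕ) (P : List Twinstack) (hP : PileInv P)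
    (hperm : ∃ k, (pileElems P ++ I).Perm (List.range' (RTM.nextOut O) k))
    (hm : RTM.nextOut O ∉ pileElems P) :
    RTM.run O P I = true ↔ ∃ D, DequeRep P D ∧ Sorts (RTM.nextOut O) D I := by
  induction I generalizing O P with
  | nil =>
    obtain ⟨k, hk⟩ := hperm
    obtain ⟨L, R, hLR⟩ := PileRep.exists_rep P
    obtain ⟨h1, h2⟩ := hLR.increasing hP
    refine iff_of_true rfl ⟨_, ⟨L, R, hLR, rfl⟩, Sorts.of_increasing_stacks (k := k) h1 h2 ?_⟩
    exact hLR.perm.trans (by simpa using hk)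
  | cons x I ih =>
    obtain ⟨k, hk⟩ := hperm
    have hnd : (pileElems P ++ x :: I).Nodup := hk.nodup_iff.mpr List.nodup_range'
    have hx : x ∉ pileElems P := fun h => (List.disjoint_of_nodup_append hnd) h (by simp)
    obtain ⟨h1, h2⟩ := normalize_fromInput hP (List.Nodup.of_append_left hnd) hx
    -- A push on the right is the mirror image of a push on the left of the reversed deque, which is
    -- represented too.
    have hpush : (∃ D, DequeRep P D ∧ Sorts (RTM.nextOut O) D (x :: I)) ↔
        ∃ D, DequeRep P D ∧ Sorts (RTM.nextOut O) (x :: D) I := by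
      constructor
      · rintro ⟨D, hD, hs⟩
        rcases (Sorts.cons_input_iff fun h => hm (hD.perm.subset h)).mp hs with hs | hs
        · exact ⟨D, hD, hs⟩
        · exact ⟨_, hD.reverse, by simpa using hs.reverse⟩
      · rintro ⟨D, hD, hs⟩
        exact ⟨D, hD, hs.a⟩
    rw [hpush, RTM.run]
    split
    · next h =>
      refine iff_of_false (by simp) ?_
      rintro ⟨D, hD, hs⟩
      exact h1 h D hD hs.noValley
    · next P' h =>
      obtain ⟨h3, h4, h5⟩ := h2 P' h
      have hperm' : (pileElems P').Perm (x :: pileElems P) := by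
        obtain ⟨L, R, hLR⟩ := PileRep.exists_rep P'
        have hD' : DequeRep P' (L ++ R.reverse) := ⟨L, R, hLR, rfl⟩
        obtain ⟨D, hD, hor⟩ := h4 _ hD'
        refine hD'.perm.symm.trans ?_
        rcases hor with hor | hor <;> rw [hor]
        · exact hD.perm.cons x
        · exact (List.perm_append_singleton x D).trans (hD.perm.cons x)
      obtain ⟨i1, i2, i3, i4⟩ := toOutput_spec O P' I h3
        ⟨k, (hperm'.append_right I).trans (List.perm_middle.symm.trans hk)⟩
      rw [ih _ _ i1 i2 i3, ← i4]
      constructor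
      · rintro ⟨D', hD', hs⟩
        obtain ⟨D, hD, rfl | rfl⟩ := h4 D' hD'
        · exact ⟨D, hD, hs⟩
        · exact ⟨_, hD.reverse, by simpa using hs.reverse⟩
      · rintro ⟨D, hD, hs⟩
        exact ⟨_, h5 D hD hs.noValley, hs⟩

theorem oneLine_perm {n : ℕ} (π : Equiv.Perm (Fin n)) :
    (oneLine π).Perm (List.range' 1 n) := by
  have h : List.range' 1 n = oneLine (Equiv.refl (Fin n)) := by
    apply List.ext_getElem <;> simp [oneLine, Nat.add_comm]
  rw [h, oneLine, oneLine]
  exact Equiv.Perm.ofFn_comp_perm π fun i => (i : ℕ) + 1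

theorem mainTheorem1 {n : ℕ} (π : Equiv.Perm (Fin n)) :
    rosenstiehlTarjanModified π = true ↔ DequeSortable π := by
  rw [dequeSortable_iff_sorts, rosenstiehlTarjanModified,
    run_eq_true_iff (oneLine π) [] [] trivial ⟨n, oneLine_perm π⟩ (by simp)]
  simp [DequeRep, PileRep.nil_iff, RTM.nextOut]
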